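/- Let $N\ge 1$, let $\Sigma\in\mathbb{R}^{N\times N}$ be symmetric positive definite, and let $\mathbf X=(X_1,\dots,X_N)$ be a random vector on a probability space $(\Omega,\mathcal F,\mathbb P)$ that is Gaussian with mean zero and covariance matrix $\Sigma$, i.e. it has the density $\phi(\mathbf x;\Sigma)=(2\pi)^{-N/2}(\det\Sigma)^{-1/2}\exp(-\tfrac12\mathbf x^T\Sigma^{-1}\mathbf x)$ on $\mathbb R^N$. For a multi-index $\mathbf j\in\mathbb N_0^N$ with degree $|\mathbf j|=j_1+\dots+j_N$ let $$H_{\mathbf j}(\mathbf x;\Sigma)=\frac{(-1)^{|\mathbf j|}}{\phi(\mathbf x;\Sigma)}\,\frac{\partial^{|\mathbf j|}\phi(\mathbf x;\Sigma)}{\partial x_1^{j_1}\cdots\partial x_N^{j_N}},\qquad \Psi_{\mathbf j}(\mathbf x;\Sigma)=\frac{H_{\mathbf j}(\mathbf x;\Sigma)}{\sqrt{\mathbb E[H_{\mathbf j}^2(\mathbf X;\Sigma)]}}$$ be the multivariate Hermite orthogonal polynomials and their standardized versions. Let $y:\mathbb R^N\to\mathbb R$ be measurable with $\mathbb E[y(\mathbf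 X)^2]<\infty$. Then the system of linear equations $$\sum_{\mathbf k\in\mathbb N_0^N,\ |\mathbf k|=|\mathbf j|} C_{\mathbf k}\,\mathbb E[\Psi_{\mathbf j}(\mathbf X;\Sigma)\Psi_{\mathbf k}(\mathbf X;\Sigma)]=\mathbb E[y(\mathbf X)\Psi_{\mathbf j}(\mathbf X;\Sigma)],\qquad \mathbf j\in\mathbb N_0^N,$$ for the expansion coefficients $C_{\mathbf j}\in\mathbb R$ of the generalized polynomial chaos expansion (PCE) of $y(\mathbf X)$ has a solution. For every solution, let $$y_m(\mathbf X)=\sum_{\mathbf j\in\mathbb N_0^N,\ |\mathbf j|\le m} C_{\mathbf j}\Psi_{\mathbf j}(\mathbf X;\Sigma)$$ be the $m$th-order generalized PCE approximation, $m\in\mathbb N_0$. Then, for every $m$, the truncation error $y(\mathbf X)-y_m(\mathbf X)$ is square-integrable and is orthogonal in $L^2(\Omega,\mathcal F,\mathbb P)$ to every element of $\operatorname{span}\{\Psi_{\mathbf j}(\mathbf X;\Sigma): 0\le|\mathbf j|\le m\}\subset L^2(\Omega,\mathcal F,\mathbb P)$. Moreover, $\mathbb E[(y(\mathbf X)-y_m(\mathbf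 X))^2]\to 0$ as $m\to\infty$. -/

import Mathlib

open MeasureTheory ProbabilityTheory Filter Topology Matrix

namespace GeneralizedPCE

/-- The centered Gaussian density on `ℝ^N` with covariance matrix `S`:
`(2π)^(-N/2) (det S)^(-1/2) exp(-xᵀ S⁻¹ x / 2)`. -/
noncomputable def gaussianDensity {N : ℕ} (S : Matrix (Fin N) (Fin N) ℝ) (x : Fin N → ℝ) : ℝ :=
  (2 * Real.pi) ^ (-(N : ℝ) / 2) * S.det ^ (-(1 / 2) : ℝ) *
    Real.exp (-(1 / 2) * (x ⬝ᵥ (S⁻¹ *ᵥ x)))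

/-- The measure `φ(x; S) dx` on `ℝ^N`. -/
noncomputable def gaussianLaw {N : ℕ} (S : Matrix (Fin N) (Fin N) ℝ) : Measure (Fin N → ℝ) :=
  volume.withDensity fun x => ENNReal.ofReal (gaussianDensity S x)

/-- The partial derivative `∂f/∂xᵢ`. -/
noncomputable def partialDeriv {N : ℕ} (i : Fin N) (f : (Fin N → ℝ) → ℝ) : (Fin N → ℝ) → ℝ :=
  fun x => lineDeriv ℝ f x (Pi.single i 1)

/-- The degree `|j| = j₁ + ⋯ + j_N` of a multi-index. -/
def degree {N : ℕ} (j : Fin N → ℕ) : ℕ := ∑ i, j i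

/-- The mixed partial derivative `∂^|j| f / ∂x₁^j₁ ⋯ ∂x_N^j_N`. -/
noncomputable def mixedPartial {N : ℕ} (j : Fin N → ℕ) (f : (Fin N → ℝ) → ℝ) :
    (Fin N → ℝ) → ℝ :=
  (List.finRange N).foldr (fun i g => (partialDeriv i)^[j i] g) f

/-- The multivariate Hermite orthogonal polynomial
`H_j(x; S) = (-1)^|j| φ(x; S)⁻¹ (∂/∂x)^j φ(x; S)`. -/
noncomputable def hermite {N : ℕ} (S : Matrix (Fin N) (Fin N) ℝ) (j : Fin N → ℕ)
    (x : Fin N → ℝ) : ℝ :=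
  (-1) ^ degree j / gaussianDensity S x * mixedPartial j (gaussianDensity S) x

/-- The standardized multivariate Hermite polynomial `Ψ_j = H_j / √(∫ H_j² φ dx)`. -/
noncomputable def stdHermite {N : ℕ} (S : Matrix (Fin N) (Fin N) ℝ) (j : Fin N → ℕ)
    (x : Fin N → ℝ) : ℝ :=
  hermite S j x / Real.sqrt (∫ z, hermite S j z ^ 2 ∂(gaussianLaw S))

/-- `C` is a family of expansion coefficients of the generalized PCE of `y(X)`: for every
multi-index `j`, `∑_{|k| = |j|} C_k E[Ψ_j(X) Ψ_k(X)] = E[y(X) Ψ_j(X)]`. -/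
def IsPCECoeff {Ω : Type*} [MeasurableSpace Ω] (P : Measure Ω) {N : ℕ}
    (S : Matrix (Fin N) (Fin N) ℝ) (X : Ω → Fin N → ℝ) (y : (Fin N → ℝ) → ℝ)
    (C : (Fin N → ℕ) → ℝ) : Prop :=
  ∀ j : Fin N → ℕ,
    ∑ k ∈ Finset.piAntidiag Finset.univ (degree j),
        C k * ∫ ω, stdHermite S j (X ω) * stdHermite S k (X ω) ∂P =
      ∫ ω, y (X ω) * stdHermite S j (X ω) ∂P

/-- The `m`th-order generalized PCE approximation
`y_m(x) = ∑_{l ≤ m} ∑_{|j| = l} C_j Ψ_j(x; S)`. -/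
noncomputable def truncatedPCE {N : ℕ} (S : Matrix (Fin N) (Fin N) ℝ) (C : (Fin N → ℕ) → ℝ)
    (m : ℕ) (x : Fin N → ℝ) : ℝ :=
  ∑ l ∈ Finset.range (m + 1), ∑ j ∈ Finset.piAntidiag Finset.univ l, C j * stdHermite S j x

end GeneralizedPCE

/-! Differentiating `p * φ` in direction `i` gives `-(raise S⁻¹ i p) * φ`, so `H_j` is a product of
commuting raising operators applied to `1`. Integration by parts makes `raise S⁻¹ i` adjoint to `∂ᵢ`
in L²(φ dx); moving `|j|` derivatives onto a polynomial of lower degree kills it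
(`integral_eval_hermitePoly_mul`). Hence different degrees are orthogonal, and the linear system
splits by degree into normal equations of projections: always solvable, and every solution gives the
orthogonal projection (`exists_coeff_of_levels`, `inner_sub_levels_eq_zero`).

Convergence is completeness. The `H_j` span all polynomials (`span_hermitePoly`). A
square-integrable `f` orthogonal to every polynomial has `f μ` with zero Fourier transform, because
exponential moments allow termwise integration of the exponential series
(`ae_eq_zero_of_integral_mul_eval_eq_zero`). -/

namespace GeneralizedPCE

/-! ### Raising operators and formal Hermite polynomials -/

section Algebra

open MvPolynomial

variable {N : ℕ} (A : Matrix (Fin N) (Fin N) ℝ)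

/-- The linear form `x ↦ (A x)ᵢ` as a polynomial. -/
noncomputable def linForm (i : Fin N) : MvPolynomial (Fin N) ℝ := ∑ k, C (A i k) * X k

lemma eval_linForm (i : Fin N) (x : Fin N → ℝ) : eval x (linForm A i) = (A *ᵥ x) i := by
  simp [linForm, Matrix.mulVec, dotProduct]

lemma pderiv_linForm (i k : Fin N) : pderiv k (linForm A i) = C (A i k) := by
  simp [linForm, Pi.single_apply]

lemma pderiv_comm (i k : Fin N) (p : MvPolynomial (Fin N) ℝ) :
    pderiv i (pderiv k p) = pderiv k (pderiv i p) := by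
  ext m
  simp only [coeff_pderiv]
  rcases eq_or_ne i k with rfl | h
  · rfl
  · simp only [Finsupp.add_apply, Finsupp.single_apply, h, h.symm, if_false, add_zero]
    rw [add_right_comm]
    ring

/-- The raising operator `p ↦ (A x)ᵢ p - ∂ᵢ p` on polynomials. -/
noncomputable def raise (i : Fin N) (p : MvPolynomial (Fin N) ℝ) : MvPolynomial (Fin N) ℝ :=
  linForm A i * p - pderiv i p

/-- The canonical commutation relation: the commutator of `∂ₖ` with a raising operator is a scalar.
-/
lemma pderiv_raise (i k : Fin N) (p : MvPolynomial (Fin N) ℝ) :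
    pderiv k (raise A i p) = raise A i (pderiv k p) + C (A i k) * p := by
  simp only [raise, map_sub, pderiv_mul, pderiv_linForm, pderiv_comm k i]
  ring

/-- The two scalar commutators `A i k` and `A k i` cancel by symmetry. -/
lemma raise_comm (hA : Aᵀ = A) (i k : Fin N) :
    Function.Commute (raise A i) (raise A k) := by
  intro p
  have h : A i k = A k i := congrFun (congrFun hA k) i
  have h1 : raise A i (raise A k p) = linForm A i * raise A k p - pderiv i (raise A k p) := rfl
  have h2 : raise A k (raise A i p) = linForm A k * raise A i p - pderiv k (raise A i p) := rfl
  rw [h1, h2, pderiv_raise, pderiv_raise, h]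
  simp only [raise, pderiv_comm i k]
  ring

/-- The product of the powers `(raise A i)^(j i)` over the list `l`, applied to `1`. -/
noncomputable def raiseList (j : Fin N → ℕ) (l : List (Fin N)) : MvPolynomial (Fin N) ℝ :=
  l.foldr (fun i p => (raise A i)^[j i] p) 1

/-- The Hermite polynomial `H_j` as a formal polynomial. -/
noncomputable def hermitePoly (j : Fin N → ℕ) : MvPolynomial (Fin N) ℝ :=
  raiseList A j (List.finRange N)

lemma raiseList_congr {j k : Fin N → ℕ} {l : List (Fin N)} (h : ∀ i ∈ l, j i = k i) :
    raiseList A j l = raiseList A k l := by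
  induction l with
  | nil => rfl
  | cons a l ih =>
    simp only [raiseList, List.foldr_cons] at ih ⊢
    rw [ih fun i hi => h i (by simp [hi]), h a (by simp)]

/-- By commutativity a new factor can travel past the others to its slot in the ordered product;
`Nodup` ensures that there is only one slot. -/
lemma raise_raiseList (hA : Aᵀ = A) (j : Fin N → ℕ) {l : List (Fin N)} (hl : l.Nodup)
    {i : Fin N} (hi : i ∈ l) :
    raise A i (raiseList A j l) = raiseList A (j + Pi.single i 1) l := by
  induction l with
  | nil => simp at hi
  | cons a l ih =>
    rw [List.nodup_cons] at hl
    simp only [raiseList, List.foldr_cons] at ih ⊢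
    rcases eq_or_ne i a with rfl | hia
    · have h : raiseList A (j + Pi.single i 1) l = raiseList A j l :=
        raiseList_congr A fun k hk => by
          have : k ≠ i := fun h => hl.1 (h ▸ hk)
          simp [this]
      simp only [raiseList] at h
      rw [h]
      simp [Function.iterate_succ_apply']
    · have hi' : i ∈ l := by simpa [hia] using hi
      rw [← ih hl.2 hi', ((raise_comm A hA i a).iterate_right (j a)).eq]
      simp [hia.symm]

lemma raise_hermitePoly (hA : Aᵀ = A) (j : Fin N → ℕ) (i : Fin N) :
    raise A i (hermitePoly A j) = hermitePoly A (j + Pi.single i 1) :=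
  raise_raiseList A hA j (List.nodup_finRange N) (List.mem_finRange i)

lemma sum_map_finRange (j : Fin N → ℕ) : ((List.finRange N).map j).sum = degree j := by
  rw [degree, ← List.sum_ofFn, List.ofFn_eq_map]

/-- Induction principle for the Hermite polynomials: a property indexed by the order which holds
for `1` and is propagated by the raising operators holds for every Hermite polynomial. -/
lemma hermitePoly_induction {Q : ℕ → MvPolynomial (Fin N) ℝ → Prop} (h1 : Q 0 1)
    (hr : ∀ n i p, Q n p → Q (n + 1) (raise A i p)) (j : Fin N → ℕ) :
    Q (degree j) (hermitePoly A j) := by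
  have key (l : List (Fin N)) : Q (l.map j).sum (raiseList A j l) := by
    induction l with
    | nil => exact h1
    | cons a l ih =>
      simp only [raiseList, List.foldr_cons, List.map_cons, List.sum_cons] at ih ⊢
      induction j a with
      | zero => simpa using ih
      | succ n ihn =>
        rw [Function.iterate_succ_apply', add_right_comm]
        exact hr _ _ _ ihn
  rw [← sum_map_finRange]
  exact key _

/-- All coefficients of `p` in degree at least `n` vanish. -/
def DegreeLT (n : ℕ) (p : MvPolynomial (Fin N) ℝ) : Prop :=
  ∀ m : Fin N →₀ ℕ, n ≤ m.degree → coeff m p = 0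

lemma DegreeLT.pderiv {n : ℕ} {p : MvPolynomial (Fin N) ℝ} (h : DegreeLT (n + 1) p) (i : Fin N) :
    DegreeLT n (MvPolynomial.pderiv i p) := by
  intro m hm
  rw [coeff_pderiv, h _ (by simp; omega), zero_mul]

lemma DegreeLT.mono {n m : ℕ} {p : MvPolynomial (Fin N) ℝ} (h : DegreeLT n p) (hnm : n ≤ m) :
    DegreeLT m p := fun k hk => h k (hnm.trans hk)

lemma DegreeLT.eq_zero {p : MvPolynomial (Fin N) ℝ} (h : DegreeLT 0 p) : p = 0 := by
  ext m
  simpa using h m (Nat.zero_le _)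

lemma DegreeLT.raise {n : ℕ} {p : MvPolynomial (Fin N) ℝ} (h : DegreeLT (n + 1) p) (i : Fin N) :
    DegreeLT (n + 2) (raise A i p) := by
  intro m hm
  rw [GeneralizedPCE.raise, coeff_sub, (h.pderiv i) m (by omega), sub_zero, linForm,
    Finset.sum_mul, coeff_sum]
  refine Finset.sum_eq_zero fun k _ => ?_
  classical
  rw [mul_assoc, coeff_C_mul, mul_comm (X k), coeff_mul_X']
  split_ifs with hk
  · rw [h, mul_zero]
    have h2 : (m - Finsupp.single k 1) + Finsupp.single k 1 = m := by
      refine tsub_add_cancel_of_le ?_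
      rw [Finsupp.single_le_iff]
      exact Nat.one_le_iff_ne_zero.2 (Finsupp.mem_support_iff.1 hk)
    have h3 := congrArg Finsupp.degree h2
    simp at h3
    omega
  · simp

lemma degreeLT_hermitePoly (j : Fin N → ℕ) : DegreeLT (degree j + 1) (hermitePoly A j) := by
  refine hermitePoly_induction A (Q := fun n p => DegreeLT (n + 1) p) ?_
    (fun n i p h => h.raise A i) j
  intro m hm
  classical
  rw [coeff_one, if_neg]
  rintro rfl
  simp at hm

/-- The Hermite polynomials span all polynomials. -/
lemma span_hermitePoly (hA : Aᵀ = A) (hdet : IsUnit A.det) :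
    Submodule.span ℝ (Set.range (hermitePoly A)) = ⊤ := by
  set V := Submodule.span ℝ (Set.range (hermitePoly A)) with hV
  have hraise (i : Fin N) (p) (hp : p ∈ V) : raise A i p ∈ V := by
    induction hp using Submodule.span_induction with
    | mem p hp =>
      obtain ⟨j, rfl⟩ := hp
      rw [raise_hermitePoly A hA]
      exact Submodule.subset_span ⟨_, rfl⟩
    | zero => simp [raise]
    | add p q _ _ hp hq =>
      have : raise A i (p + q) = raise A i p + raise A i q := by
        simp only [raise, map_add]; ring
      rw [this]
      exact V.add_mem hp hq
    | smul c p _ hp =>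
      have : raise A i (c • p) = c • raise A i p := by
        simp only [raise, Derivation.map_smul, smul_sub, mul_smul_comm]
      rw [this]
      exact V.smul_mem c hp
  have hone : (1 : MvPolynomial (Fin N) ℝ) ∈ V := by
    refine Submodule.subset_span ⟨0, ?_⟩
    have key (l : List (Fin N)) : raiseList A 0 l = 1 := by
      induction l with
      | nil => rfl
      | cons a l ih => exact ih
    exact key _
  -- The induction carries `p ∈ V` along with its derivatives, since the commutator contributes a
  -- multiple of `p`.
  have hpd (p) (hp : p ∈ V) : ∀ k, pderiv k p ∈ V := by
    induction hp using Submodule.span_induction with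
    | mem p hp =>
      obtain ⟨j, rfl⟩ := hp
      refine (hermitePoly_induction A (Q := fun _ p => p ∈ V ∧ ∀ k, pderiv k p ∈ V)
        ⟨hone, fun k => by simp⟩ (fun _ i p hp => ⟨hraise i p hp.1, fun k => ?_⟩) j).2
      rw [pderiv_raise, ← smul_eq_C_mul]
      exact V.add_mem (hraise i _ (hp.2 k)) (V.smul_mem _ hp.1)
    | zero => simp
    | add p q _ _ hp hq => exact fun k => by rw [map_add]; exact V.add_mem (hp k) (hq k)
    | smul c p _ hp => exact fun k => by rw [Derivation.map_smul]; exact V.smul_mem c (hp k)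
  have hlin (p) (hp : p ∈ V) (i : Fin N) : linForm A i * p ∈ V := by
    have : linForm A i * p = raise A i p + pderiv i p := by simp [raise]
    rw [this]
    exact V.add_mem (hraise i p hp) (hpd p hp i)
  -- Invertibility of `A` recovers the coordinates from the linear forms, so `V` is stable under
  -- multiplication by each variable.
  have hX (k : Fin N) : (X k : MvPolynomial (Fin N) ℝ) = ∑ i, C (A⁻¹ k i) * linForm A i := by
    have h1 : A⁻¹ * A = 1 := Matrix.nonsing_inv_mul A hdet
    simp only [linForm, Finset.mul_sum]
    rw [Finset.sum_comm]
    have (l : Fin N) : ∑ i, C (A⁻¹ k i) * (C (A i l) * X l) =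
        (C ((1 : Matrix (Fin N) (Fin N) ℝ) k l) * X l : MvPolynomial (Fin N) ℝ) := by
      rw [← h1, Matrix.mul_apply, map_sum, Finset.sum_mul]
      simp [mul_assoc]
    simp [this, Matrix.one_apply]
  rw [eq_top_iff]
  rintro p -
  induction p using MvPolynomial.induction_on with
  | C a => rw [← mul_one (C a), ← smul_eq_C_mul]; exact V.smul_mem a hone
  | add p q hp hq => exact V.add_mem hp hq
  | mul_X p k hp =>
    rw [hX, mul_comm, Finset.sum_mul]
    refine V.sum_mem fun i _ => ?_
    rw [mul_assoc, ← smul_eq_C_mul]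
    exact V.smul_mem _ (hlin p hp i)

end Algebra

/-! ### Projections along a graded family in a Hilbert space -/

section Hilbert

open scoped InnerProductSpace

variable {H : Type*} [NormedAddCommGroup H] [InnerProductSpace ℝ H]
  {ι : Type*} {d : ι → ℕ} {s : ℕ → Finset ι} {ψ : ι → H}

/-- The normal equations of the orthogonal projection onto the span of each level of a graded
family are solvable. -/
lemma exists_coeff_of_levels (hs : ∀ l k, k ∈ s l ↔ d k = l) (y : H) :
    ∃ c : ι → ℝ, ∀ j, ∑ k ∈ s (d j), c k * ⟪ψ j, ψ k⟫_ℝ = ⟪y, ψ j⟫_ℝ := by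
  have h (l : ℕ) : ∃ c : ι → ℝ, ∀ j, d j = l → ∑ k ∈ s l, c k * ⟪ψ j, ψ k⟫_ℝ = ⟪y, ψ j⟫_ℝ := by
    -- The Gram matrix of a level may be singular; coefficients of the projection of `y` onto its
    -- span still solve the block.
    let W := Submodule.span ℝ (ψ '' (s l : Set ι))
    have : FiniteDimensional ℝ W :=
      FiniteDimensional.span_of_finite ℝ ((s l).finite_toSet.image ψ)
    have hW : W.starProjection y ∈ W := W.starProjection_apply_mem y
    obtain ⟨c, hc⟩ := (Submodule.mem_span_image_finset_iff_exists_fun' ℝ).1 hW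
    refine ⟨c, fun j hj => ?_⟩
    have hjW : ψ j ∈ W := Submodule.subset_span ⟨j, (hs l j).2 hj, rfl⟩
    have := W.starProjection_inner_eq_zero y (ψ j) hjW
    rw [inner_sub_left, sub_eq_zero, ← hc, sum_inner] at this
    rw [this]
    exact Finset.sum_congr rfl fun k _ => by rw [real_inner_smul_left, real_inner_comm]
  choose c hc using h
  -- The levels are disjoint, so the solutions of the blocks glue.
  refine ⟨fun k => c (d k) k, fun j => ?_⟩
  rw [← hc _ j rfl]
  exact Finset.sum_congr rfl fun k hk => by simp only [(hs _ _).1 hk]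

lemma inner_sub_levels_eq_zero (hs : ∀ l k, k ∈ s l ↔ d k = l)
    (horth : ∀ j k, d j ≠ d k → ⟪ψ j, ψ k⟫_ℝ = 0) {y : H} {c : ι → ℝ}
    (hc : ∀ j, ∑ k ∈ s (d j), c k * ⟪ψ j, ψ k⟫_ℝ = ⟪y, ψ j⟫_ℝ) {m : ℕ} {j : ι} (hj : d j ≤ m) :
    ⟪y - ∑ l ∈ Finset.range (m + 1), ∑ k ∈ s l, c k • ψ k, ψ j⟫_ℝ = 0 := by
  rw [inner_sub_left, sum_inner, Finset.sum_eq_single (d j), ← hc, sum_inner, sub_eq_zero]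
  · exact Finset.sum_congr rfl fun k _ => by rw [real_inner_smul_left, real_inner_comm]
  · intro l _ hl
    rw [sum_inner]
    refine Finset.sum_eq_zero fun k hk => ?_
    rw [real_inner_smul_left, horth k j (by rw [(hs l k).1 hk]; exact hl), mul_zero]
  · intro h
    exact absurd (Finset.mem_range.2 (by omega)) h

/-- The partial sum is the best approximation of `y` from `V m`, by Pythagoras, and the increasing
spaces `V m` exhaust the span, whose closure contains `y`. -/
lemma tendsto_norm_sub_levels (hs : ∀ l k, k ∈ s l ↔ d k = l)
    (horth : ∀ j k, d j ≠ d k → ⟪ψ j, ψ k⟫_ℝ = 0) {y : H} {c : ι → ℝ}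
    (hc : ∀ j, ∑ k ∈ s (d j), c k * ⟪ψ j, ψ k⟫_ℝ = ⟪y, ψ j⟫_ℝ)
    (hy : y ∈ (Submodule.span ℝ (Set.range ψ)).topologicalClosure) :
    Tendsto (fun m => ‖y - ∑ l ∈ Finset.range (m + 1), ∑ k ∈ s l, c k • ψ k‖) atTop (𝓝 0) := by
  let V (m : ℕ) : Submodule ℝ H := Submodule.span ℝ (ψ '' {j | d j ≤ m})
  have hV : Monotone V := fun a b hab =>
    Submodule.span_mono (Set.image_mono fun j (hj : d j ≤ a) => hj.trans hab)
  have hmem (m : ℕ) : ∑ l ∈ Finset.range (m + 1), ∑ k ∈ s l, c k • ψ k ∈ V m := by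
    refine Submodule.sum_mem _ fun l hl => Submodule.sum_mem _ fun k hk =>
      Submodule.smul_mem _ _ (Submodule.subset_span ⟨k, ?_, rfl⟩)
    have := (hs l k).1 hk
    have := Finset.mem_range.1 hl
    show d k ≤ m
    omega
  have horthV (m : ℕ) (v) (hv : v ∈ V m) :
      ⟪y - ∑ l ∈ Finset.range (m + 1), ∑ k ∈ s l, c k • ψ k, v⟫_ℝ = 0 := by
    induction hv using Submodule.span_induction with
    | mem v hv =>
      obtain ⟨j, hj, rfl⟩ := hv
      exact inner_sub_levels_eq_zero hs horth hc hj
    | zero => simp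
    | add u v _ _ hu hv => rw [inner_add_right, hu, hv, add_zero]
    | smul a v _ hv => rw [real_inner_smul_right, hv, mul_zero]
  have hexists (v) (hv : v ∈ Submodule.span ℝ (Set.range ψ)) : ∃ m, v ∈ V m := by
    induction hv using Submodule.span_induction with
    | mem v hv =>
      obtain ⟨j, rfl⟩ := hv
      exact ⟨d j, Submodule.subset_span ⟨j, le_refl (d j), rfl⟩⟩
    | zero => exact ⟨0, Submodule.zero_mem _⟩
    | add u v _ _ hu hv =>
      obtain ⟨a, ha⟩ := hu
      obtain ⟨b, hb⟩ := hv
      exact ⟨max a b, Submodule.add_mem _ (hV (le_max_left a b) ha) (hV (le_max_right a b) hb)⟩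
    | smul r v _ hv =>
      obtain ⟨a, ha⟩ := hv
      exact ⟨a, Submodule.smul_mem _ r ha⟩
  rw [Metric.tendsto_atTop]
  intro ε hε
  obtain ⟨v, hv, hyv⟩ := Metric.mem_closure_iff.1 hy ε hε
  obtain ⟨m₀, hm₀⟩ := hexists v hv
  refine ⟨m₀, fun m hm => ?_⟩
  rw [dist_zero_right, norm_norm]
  refine lt_of_le_of_lt ?_ hyv
  set z := ∑ l ∈ Finset.range (m + 1), ∑ k ∈ s l, c k • ψ k
  have h0 : ⟪y - z, z - v⟫_ℝ = 0 := horthV m _ (Submodule.sub_mem _ (hmem m) (hV hm hm₀))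
  have h1 := norm_add_sq_eq_norm_sq_add_norm_sq_real h0
  rw [sub_add_sub_cancel] at h1
  rw [dist_eq_norm]
  nlinarith [norm_nonneg (y - z), norm_nonneg (y - v), norm_nonneg (z - v)]

end Hilbert

/-! ### Completeness of polynomials under exponential moments -/

section Density

open MvPolynomial

variable {N : ℕ} {μ : Measure (Fin N → ℝ)}

lemma memLp_exp_dotProduct (hexp : ∀ t : Fin N → ℝ, Integrable (fun x => Real.exp (t ⬝ᵥ x)) μ)
    (t : Fin N → ℝ) : MemLp (fun x => Real.exp (t ⬝ᵥ x)) 2 μ := by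
  rw [memLp_two_iff_integrable_sq (hexp t).aestronglyMeasurable]
  refine (hexp ((2 : ℝ) • t)).congr (Eventually.of_forall fun x => ?_)
  simp [← Real.exp_nat_mul]

/-- Each multiplication by a variable in `memLp_eval` halves the exponent. -/
lemma holderTriple_two_pow (n : ℕ) :
    ENNReal.HolderTriple ((2 : ENNReal) ^ (n + 1)) (2 ^ (n + 1)) (2 ^ n) where
  inv_add_inv_eq_inv := by
    rw [pow_succ, ENNReal.mul_inv (by simp) (by simp), ← mul_add, ENNReal.inv_two_add_inv_two,
      mul_one]

/-- Polynomials have finite moments under a measure with finite exponential moments. -/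
lemma memLp_eval [IsFiniteMeasure μ]
    (hexp : ∀ t : Fin N → ℝ, Integrable (fun x => Real.exp (t ⬝ᵥ x)) μ)
    (p : MvPolynomial (Fin N) ℝ) (n : ℕ) : MemLp (fun x => eval x p) (2 ^ n) μ := by
  have hX (i : Fin N) (n : ℕ) : MemLp (fun x : Fin N → ℝ => x i) (2 ^ n) μ := by
    have huniv : integrableExpSet (fun x : Fin N → ℝ => x i) μ = Set.univ := by
      refine Set.eq_univ_of_forall fun a => ?_
      refine (hexp (Pi.single i a)).congr (Eventually.of_forall fun x => ?_)
      simp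
    have := memLp_of_mem_interior_integrableExpSet (X := fun x : Fin N → ℝ => x i) (μ := μ)
      (by simp [huniv]) (2 ^ n)
    simpa using this
  induction p using MvPolynomial.induction_on generalizing n with
  | C a => simpa using memLp_const a
  | add p q hp hq => simpa only [eval_add] using! (hp n).add (hq n)
  | mul_X p i hp =>
    have := holderTriple_two_pow n
    simpa only [eval_mul, eval_X] using! MemLp.mul (hX i (n + 1)) (hp (n + 1))

lemma memLp_eval_two [IsFiniteMeasure μ]
    (hexp : ∀ t : Fin N → ℝ, Integrable (fun x => Real.exp (t ⬝ᵥ x)) μ)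
    (p : MvPolynomial (Fin N) ℝ) : MemLp (fun x => eval x p) 2 μ := by
  simpa using memLp_eval hexp p 1

/-- Follows from `exp |s| ≤ exp s + exp (-s)`; this is the dominating function for the exponential
series. -/
lemma integrable_mul_exp_abs (hexp : ∀ t : Fin N → ℝ, Integrable (fun x => Real.exp (t ⬝ᵥ x)) μ)
    {f : (Fin N → ℝ) → ℝ} (hf : MemLp f 2 μ) (t : Fin N → ℝ) :
    Integrable (fun x => |f x| * Real.exp |t ⬝ᵥ x|) μ := by
  have h := (hf.abs.integrable_mul (memLp_exp_dotProduct hexp t)).add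
    (hf.abs.integrable_mul (memLp_exp_dotProduct hexp (-t)))
  refine h.mono' ?_ (Eventually.of_forall fun x => ?_)
  · refine hf.abs.aestronglyMeasurable.mul ?_
    exact (by fun_prop : Continuous fun x => Real.exp |t ⬝ᵥ x|).aestronglyMeasurable
  · simp only [Pi.add_apply, Pi.mul_apply, neg_dotProduct, Pi.abs_apply]
    rw [Real.norm_of_nonneg (by positivity), ← mul_add]
    refine mul_le_mul_of_nonneg_left ?_ (abs_nonneg _)
    rcases abs_cases (t ⬝ᵥ x) with ⟨h, _⟩ | ⟨h, _⟩ <;> rw [h] <;>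
      linarith [Real.exp_pos (t ⬝ᵥ x), Real.exp_pos (-(t ⬝ᵥ x))]

lemma strongDual_apply_eq_dotProduct (L : StrongDual ℝ (Fin N → ℝ)) (x : Fin N → ℝ) :
    L x = (fun i => L (Pi.single i 1)) ⬝ᵥ x := by
  have := LinearMap.pi_apply_eq_sum_univ (L : (Fin N → ℝ) →ₗ[ℝ] ℝ) x
  simp only [ContinuousLinearMap.coe_coe] at this
  rw [this, dotProduct]
  refine Finset.sum_congr rfl fun i _ => ?_
  rw [smul_eq_mul, mul_comm]
  congr 2
  ext k
  simp [Pi.single_apply, eq_comm]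

/-- The Fourier transform of `f μ` vanishes if `f` is orthogonal to all polynomials. -/
lemma integral_mul_cexp_eq_zero (hexp : ∀ t : Fin N → ℝ, Integrable (fun x => Real.exp (t ⬝ᵥ x)) μ)
    {f : (Fin N → ℝ) → ℝ} (hf : MemLp f 2 μ)
    (h : ∀ p : MvPolynomial (Fin N) ℝ, ∫ x, f x * eval x p ∂μ = 0) (t : Fin N → ℝ) :
    ∫ x, (f x : ℂ) * Complex.exp ((t ⬝ᵥ x : ℝ) * Complex.I) ∂μ = 0 := by
  have hbound (x : Fin N → ℝ) : HasSum (fun n : ℕ => |f x| * (|t ⬝ᵥ x| ^ n / n.factorial))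
      (|f x| * Real.exp |t ⬝ᵥ x|) := by
    rw [Real.exp_eq_exp_ℝ]
    exact (NormedSpace.expSeries_div_hasSum_exp |t ⬝ᵥ x|).mul_left _
  have hsum := hasSum_integral_of_dominated_convergence (μ := μ)
    (F := fun (n : ℕ) x => (f x : ℂ) * (((t ⬝ᵥ x : ℝ) * Complex.I) ^ n / n.factorial))
    (f := fun x => (f x : ℂ) * Complex.exp ((t ⬝ᵥ x : ℝ) * Complex.I))
    (fun n x => |f x| * (|t ⬝ᵥ x| ^ n / n.factorial))
    (fun n => (Complex.continuous_ofReal.comp_aestronglyMeasurable hf.aestronglyMeasurable).mul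
      (by fun_prop : Continuous fun x : Fin N → ℝ =>
        ((t ⬝ᵥ x : ℝ) * Complex.I) ^ n / (n.factorial : ℂ)).aestronglyMeasurable)
    (fun n => Eventually.of_forall fun x => by simp)
    (Eventually.of_forall fun x => (hbound x).summable)
    (by simpa only [(hbound _).tsum_eq] using integrable_mul_exp_abs hexp hf t)
    (Eventually.of_forall fun x => by
      rw [Complex.exp_eq_exp_ℂ]
      exact (NormedSpace.expSeries_div_hasSum_exp ((t ⬝ᵥ x : ℝ) * Complex.I : ℂ)).mul_left _)
  refine hsum.unique ?_
  convert hasSum_zero with n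
  -- Each term of the series is a multiple of the integral of `f` against a polynomial.
  have hpoly : ∫ x, f x * (t ⬝ᵥ x) ^ n ∂μ = 0 := by
    have := h ((∑ i, C (t i) * X i) ^ n)
    simpa [dotProduct] using this
  have heq : (fun x => (f x : ℂ) * (((t ⬝ᵥ x : ℝ) * Complex.I) ^ n / n.factorial)) =
      fun x => (Complex.I ^ n / n.factorial) * ((f x * (t ⬝ᵥ x) ^ n : ℝ) : ℂ) := by
    ext x
    push_cast
    ring
  rw [heq, integral_const_mul, integral_complex_ofReal, hpoly]
  simp

/-- Under a finite measure with finite exponential moments, a square-integrable function which is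
orthogonal to all polynomials vanishes. -/
theorem ae_eq_zero_of_integral_mul_eval_eq_zero [IsFiniteMeasure μ]
    (hexp : ∀ t : Fin N → ℝ, Integrable (fun x => Real.exp (t ⬝ᵥ x)) μ)
    {f : (Fin N → ℝ) → ℝ} (hf : MemLp f 2 μ)
    (h : ∀ p : MvPolynomial (Fin N) ℝ, ∫ x, f x * eval x p ∂μ = 0) : f =ᵐ[μ] 0 := by
  have hfi : Integrable f μ := hf.integrable one_le_two
  have hpos : AEMeasurable (fun x => ENNReal.ofReal (f x)) μ := hfi.aemeasurable.ennreal_ofReal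
  have hneg : AEMeasurable (fun x => ENNReal.ofReal (-f x)) μ :=
    hfi.neg.aemeasurable.ennreal_ofReal
  have hposfin : ∫⁻ x, ENNReal.ofReal (f x) ∂μ ≠ ⊤ := hfi.lintegral_lt_top.ne
  have hnegfin : ∫⁻ x, ENNReal.ofReal (-f x) ∂μ ≠ ⊤ := hfi.neg.lintegral_lt_top.ne
  have := isFiniteMeasure_withDensity hposfin
  have := isFiniteMeasure_withDensity hnegfin
  -- The positive and negative parts of `f μ` are finite measures whose characteristic functions
  -- differ by the Fourier transform of `f μ`, which is zero.
  have hmeas : μ.withDensity (fun x => ENNReal.ofReal (f x)) =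
      μ.withDensity (fun x => ENNReal.ofReal (-f x)) := by
    refine Measure.ext_of_charFunDual (funext fun L => ?_)
    rw [charFunDual_apply, charFunDual_apply,
      integral_withDensity_eq_integral_toReal_smul₀ hpos (by simp),
      integral_withDensity_eq_integral_toReal_smul₀ hneg (by simp), ← sub_eq_zero]
    have hint {g : (Fin N → ℝ) → ℝ} (hg : Integrable g μ) :
        Integrable (fun x => (ENNReal.ofReal (g x)).toReal • Complex.exp (L x * Complex.I)) μ := by
      refine hg.norm.mono' ?_ (Eventually.of_forall fun x => ?_)
      · exact hg.aemeasurable.ennreal_ofReal.ennreal_toReal.aestronglyMeasurable.smul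
          (by fun_prop : Continuous fun x => Complex.exp (L x * Complex.I)).aestronglyMeasurable
      · rw [norm_smul, Complex.norm_exp_ofReal_mul_I, mul_one, ENNReal.toReal_ofReal',
          Real.norm_of_nonneg (le_max_right _ _)]
        exact max_le (le_abs_self _) (abs_nonneg _)
    refine (integral_sub (hint hfi) (hint hfi.neg)).symm.trans ?_
    rw [← integral_mul_cexp_eq_zero hexp hf h fun i => L (Pi.single i 1)]
    congr with x
    rw [← strongDual_apply_eq_dotProduct, ← sub_smul, Complex.real_smul]
    congr 2
    simp only [ENNReal.toReal_ofReal', Pi.neg_apply]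
    rcases le_total (f x) 0 with h | h <;> simp [h]
  rw [withDensity_eq_iff hpos hneg hposfin] at hmeas
  filter_upwards [hmeas] with x hx
  rcases le_total (f x) 0 with h0 | h0
  · have := (ENNReal.ofReal_eq_zero.2 h0).symm.trans hx
    have := ENNReal.ofReal_eq_zero.1 this.symm
    exact le_antisymm h0 (neg_nonpos.1 this)
  · have := hx.trans (ENNReal.ofReal_eq_zero.2 (by linarith))
    exact le_antisymm (ENNReal.ofReal_eq_zero.1 this) h0

end Density

/-! ### Gaussian density, Rodrigues formula and orthogonality -/

section Gaussian

open MvPolynomial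

variable {N : ℕ} {S : Matrix (Fin N) (Fin N) ℝ}

lemma gaussianDensity_pos (hS : S.PosDef) (x : Fin N → ℝ) : 0 < gaussianDensity S x :=
  mul_pos (mul_pos (Real.rpow_pos_of_pos (by positivity) _) (Real.rpow_pos_of_pos hS.det_pos _))
    (Real.exp_pos _)

lemma continuous_gaussianDensity : Continuous (gaussianDensity S) := by
  unfold gaussianDensity
  fun_prop

lemma measurable_ofReal_gaussianDensity :
    Measurable fun x => ENNReal.ofReal (gaussianDensity S x) :=
  continuous_gaussianDensity.measurable.ennreal_ofReal

lemma integrable_gaussianLaw_iff (hS : S.PosDef) {g : (Fin N → ℝ) → ℝ} :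
    Integrable g (gaussianLaw S) ↔ Integrable fun x => g x * gaussianDensity S x := by
  rw [gaussianLaw, integrable_withDensity_iff measurable_ofReal_gaussianDensity (by simp)]
  simp only [ENNReal.toReal_ofReal (gaussianDensity_pos hS _).le]

lemma integral_gaussianLaw (hS : S.PosDef) (g : (Fin N → ℝ) → ℝ) :
    ∫ x, g x ∂(gaussianLaw S) = ∫ x, g x * gaussianDensity S x := by
  rw [gaussianLaw, integral_withDensity_eq_integral_toReal_smul measurable_ofReal_gaussianDensity
    (by simp)]
  simp only [ENNReal.toReal_ofReal (gaussianDensity_pos hS _).le, smul_eq_mul, mul_comm]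

lemma transpose_inv_eq (hS : S.PosDef) : S⁻¹ᵀ = S⁻¹ := by
  simpa [conjTranspose_eq_transpose_of_trivial] using hS.inv.isHermitian.eq

/-- Completing the square turns an exponential tilt into a translation by `S t`, hence finite
exponential moments. -/
lemma exp_mul_gaussianDensity (hS : S.PosDef) (t x : Fin N → ℝ) :
    Real.exp (t ⬝ᵥ x) * gaussianDensity S x =
      Real.exp ((1 / 2) * (t ⬝ᵥ (S *ᵥ t))) * gaussianDensity S (x - S *ᵥ t) := by
  have hu : IsUnit S.det := hS.det_pos.ne'.isUnit
  have h1 : S⁻¹ *ᵥ (S *ᵥ t) = t := by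
    rw [mulVec_mulVec, nonsing_inv_mul S hu, one_mulVec]
  have h2 : (S *ᵥ t) ⬝ᵥ (S⁻¹ *ᵥ x) = t ⬝ᵥ x := by
    rw [dotProduct_mulVec, ← mulVec_transpose, transpose_inv_eq hS, h1]
  have h3 : x ⬝ᵥ t = t ⬝ᵥ x := dotProduct_comm _ _
  have h4 : (S *ᵥ t) ⬝ᵥ t = t ⬝ᵥ (S *ᵥ t) := dotProduct_comm _ _
  simp only [gaussianDensity, mulVec_sub, dotProduct_sub, sub_dotProduct, h1, h2, h3, h4]
  rw [mul_left_comm, ← Real.exp_add, mul_left_comm, ← Real.exp_add]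
  congr 2
  ring

lemma integrable_exp_gaussianLaw (hS : S.PosDef) [IsFiniteMeasure (gaussianLaw S)]
    (t : Fin N → ℝ) : Integrable (fun x => Real.exp (t ⬝ᵥ x)) (gaussianLaw S) := by
  have h : Integrable (gaussianDensity S) := by
    have := (integrable_gaussianLaw_iff hS).1 (integrable_const (μ := gaussianLaw S) (1 : ℝ))
    simpa using this
  rw [integrable_gaussianLaw_iff hS]
  simp only [exp_mul_gaussianDensity hS]
  exact (h.comp_sub_right (S *ᵥ t)).const_mul _

lemma hasLineDerivAt_eval (p : MvPolynomial (Fin N) ℝ) (x : Fin N → ℝ) (i : Fin N) :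
    HasLineDerivAt ℝ (fun x => eval x p) (eval x (pderiv i p)) x (Pi.single i 1) := by
  induction p using MvPolynomial.induction_on with
  | C a => simpa [HasLineDerivAt] using hasDerivAt_const (0 : ℝ) a
  | add p q hp hq => simpa only [HasLineDerivAt, map_add] using! HasDerivAt.add hp hq
  | mul_X p k hp =>
    have hk : HasDerivAt (fun t : ℝ => (x + t • (Pi.single i 1 : Fin N → ℝ)) k)
        ((Pi.single i 1 : Fin N → ℝ) k) 0 := by
      simpa using ((hasDerivAt_id (0 : ℝ)).mul_const ((Pi.single i 1 : Fin N → ℝ) k)).const_add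
        (x k)
    simp only [HasLineDerivAt, eval_mul, eval_X]
    refine (HasDerivAt.mul hp hk).congr_deriv ?_
    simp only [pderiv_mul, pderiv_X, eval_add, eval_mul, eval_X, zero_smul, add_zero]
    rcases eq_or_ne k i with rfl | h
    · simp
    · simp [h]

lemma hasLineDerivAt_gaussianDensity (hS : S.PosDef) (x : Fin N → ℝ) (i : Fin N) :
    HasLineDerivAt ℝ (gaussianDensity S) (-(S⁻¹ *ᵥ x) i * gaussianDensity S x) x
      (Pi.single i 1) := by
  have hsymm (k : Fin N) : S⁻¹ k i = S⁻¹ i k := congrFun (congrFun (transpose_inv_eq hS) i) k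
  -- The exponent is treated as a polynomial, so its derivative comes from `pderiv`; symmetry of
  -- `S⁻¹` merges the two product-rule terms.
  have h := hasLineDerivAt_eval (C (-(1 / 2)) * ∑ k, X k * linForm S⁻¹ k) x i
  have hq (z : Fin N → ℝ) : eval z (C (-(1 / 2)) * ∑ k, X k * linForm S⁻¹ k) =
      -(1 / 2) * (z ⬝ᵥ (S⁻¹ *ᵥ z)) := by
    simp [eval_linForm, dotProduct]
  have hd : eval x (pderiv i (C (-(1 / 2)) * ∑ k, X k * linForm S⁻¹ k)) = -(S⁻¹ *ᵥ x) i := by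
    rw [pderiv_C_mul, map_sum]
    simp only [pderiv_mul, pderiv_linForm, pderiv_X, eval_mul, eval_C, eval_add, map_sum,
      eval_linForm, eval_X, hsymm, Finset.sum_add_distrib]
    have h1 : ∑ k, eval x (Pi.single (M := fun _ => MvPolynomial (Fin N) ℝ) i 1 k) *
        (S⁻¹ *ᵥ x) k = (S⁻¹ *ᵥ x) i := by
      rw [Finset.sum_eq_single i] <;> simp +contextual
    have h2 : ∑ k, x k * S⁻¹ i k = (S⁻¹ *ᵥ x) i := by
      simp [mulVec, dotProduct, mul_comm]
    rw [h1, h2]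
    ring
  rw [hd] at h
  simp only [hq] at h
  have := (HasDerivAt.exp h).const_mul
    ((2 * Real.pi) ^ (-(N : ℝ) / 2) * S.det ^ (-(1 / 2) : ℝ))
  refine this.congr_deriv ?_
  simp only [gaussianDensity, zero_smul, add_zero]
  ring

lemma hasLineDerivAt_eval_mul_gaussianDensity (hS : S.PosDef) (p : MvPolynomial (Fin N) ℝ)
    (x : Fin N → ℝ) (i : Fin N) :
    HasLineDerivAt ℝ (fun x => eval x p * gaussianDensity S x)
      (-eval x (raise S⁻¹ i p) * gaussianDensity S x) x (Pi.single i 1) := by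
  refine (HasDerivAt.mul (hasLineDerivAt_eval p x i)
    (hasLineDerivAt_gaussianDensity hS x i)).congr_deriv ?_
  simp only [raise, eval_sub, eval_mul, eval_linForm, zero_smul, add_zero]
  ring

lemma partialDeriv_const_mul_eval_mul (hS : S.PosDef) (c : ℝ) (p : MvPolynomial (Fin N) ℝ)
    (i : Fin N) :
    partialDeriv i (fun x => c * (eval x p * gaussianDensity S x)) =
      fun x => (-1 * c) * (eval x (raise S⁻¹ i p) * gaussianDensity S x) := by
  ext x
  refine (HasDerivAt.const_mul c
    (hasLineDerivAt_eval_mul_gaussianDensity hS p x i)).deriv.trans ?_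
  ring

lemma mixedPartial_gaussianDensity (hS : S.PosDef) (j : Fin N → ℕ) :
    mixedPartial j (gaussianDensity S) =
      fun x => (-1) ^ degree j * (eval x (hermitePoly S⁻¹ j) * gaussianDensity S x) := by
  have key (l : List (Fin N)) :
      l.foldr (fun i g => (partialDeriv i)^[j i] g) (gaussianDensity S) =
        fun x => (-1) ^ (l.map j).sum * (eval x (raiseList S⁻¹ j l) * gaussianDensity S x) := by
    induction l with
    | nil => simp [raiseList]
    | cons a l ih =>
      simp only [raiseList, List.foldr_cons, List.map_cons, List.sum_cons] at ih ⊢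
      rw [ih]
      induction j a with
      | zero => simp
      | succ n ihn =>
        rw [Function.iterate_succ_apply', ihn, partialDeriv_const_mul_eval_mul hS,
          Function.iterate_succ_apply', add_right_comm, pow_succ' _ (n + _)]
  rw [mixedPartial, key, sum_map_finRange]
  rfl

lemma hermite_eq_eval (hS : S.PosDef) (j : Fin N → ℕ) (x : Fin N → ℝ) :
    hermite S j x = eval x (hermitePoly S⁻¹ j) := by
  have h := (gaussianDensity_pos hS x).ne'
  have h1 : ((-1 : ℝ) ^ degree j) * (-1) ^ degree j = 1 := by
    rw [← mul_pow]; simp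
  simp only [hermite, mixedPartial_gaussianDensity hS]
  field_simp
  linear_combination (eval x (hermitePoly S⁻¹ j)) * h1

variable [IsFiniteMeasure (gaussianLaw S)]

lemma integrable_eval_gaussianLaw (hS : S.PosDef) (p : MvPolynomial (Fin N) ℝ) :
    Integrable (fun x => eval x p) (gaussianLaw S) :=
  (memLp_eval_two (integrable_exp_gaussianLaw hS) p).integrable one_le_two

/-- Gaussian integration by parts: the raising operators are adjoint to the partial
derivatives. -/
lemma integral_eval_raise_mul (hS : S.PosDef) (i : Fin N) (p q : MvPolynomial (Fin N) ℝ) :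
    ∫ x, eval x (raise S⁻¹ i p * q) ∂(gaussianLaw S) =
      ∫ x, eval x (p * pderiv i q) ∂(gaussianLaw S) := by
  have hint (r : MvPolynomial (Fin N) ℝ) : Integrable fun x => eval x r * gaussianDensity S x :=
    (integrable_gaussianLaw_iff hS).1 (integrable_eval_gaussianLaw hS r)
  have h := integral_bilinear_hasLineDerivAt_right_eq_neg_left_of_integrable
    (μ := (volume : Measure (Fin N → ℝ))) (B := ContinuousLinearMap.mul ℝ ℝ)
    (f := fun x => eval x q) (f' := fun x => eval x (pderiv i q))
    (g := fun x => eval x p * gaussianDensity S x)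
    (g' := fun x => -eval x (raise S⁻¹ i p) * gaussianDensity S x) (v := Pi.single i 1)
    ((hint (pderiv i q * p)).congr (Eventually.of_forall fun x => by simp [mul_assoc]))
    ((hint (-(q * raise S⁻¹ i p))).congr (Eventually.of_forall fun x => by simp [mul_assoc]))
    ((hint (q * p)).congr (Eventually.of_forall fun x => by simp [mul_assoc]))
    (fun x _ => hasLineDerivAt_eval q x i)
    (fun x _ => hasLineDerivAt_eval_mul_gaussianDensity hS p x i)
  simp only [ContinuousLinearMap.mul_apply'] at h
  rw [integral_gaussianLaw hS, integral_gaussianLaw hS]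
  have h' := congrArg Neg.neg h
  rw [neg_neg, ← integral_neg] at h'
  convert h' using 3 with x x
  · rw [eval_mul]; ring
  · rw [eval_mul]; ring

lemma integral_eval_hermitePoly_mul (hS : S.PosDef) (j : Fin N → ℕ) {q : MvPolynomial (Fin N) ℝ}
    (hq : DegreeLT (degree j) q) :
    ∫ x, eval x (hermitePoly S⁻¹ j * q) ∂(gaussianLaw S) = 0 := by
  -- The claim ranges over all `q`, as each step replaces `q` by a derivative; at order `0`,
  -- `DegreeLT 0` forces `q = 0`.
  refine hermitePoly_induction S⁻¹
    (Q := fun n p => ∀ q, DegreeLT n q → ∫ x, eval x (p * q) ∂(gaussianLaw S) = 0)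
    (fun q hq => by simp [hq.eq_zero]) (fun n i p hp q hq => ?_) j q hq
  rw [integral_eval_raise_mul hS]
  exact hp _ (hq.pderiv i)

lemma integral_hermite_mul_hermite (hS : S.PosDef) {j k : Fin N → ℕ} (hjk : degree j ≠ degree k) :
    ∫ x, hermite S j x * hermite S k x ∂(gaussianLaw S) = 0 := by
  simp only [hermite_eq_eval hS, ← eval_mul]
  rcases hjk.lt_or_gt with h | h
  · rw [mul_comm]
    exact integral_eval_hermitePoly_mul hS k ((degreeLT_hermitePoly _ j).mono h)
  · exact integral_eval_hermitePoly_mul hS j ((degreeLT_hermitePoly _ k).mono h)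

lemma memLp_hermite (hS : S.PosDef) (j : Fin N → ℕ) : MemLp (hermite S j) 2 (gaussianLaw S) :=
  (memLp_congr_ae (Eventually.of_forall fun x => hermite_eq_eval hS j x)).2
    (memLp_eval_two (integrable_exp_gaussianLaw hS) _)

lemma memLp_stdHermite (hS : S.PosDef) (j : Fin N → ℕ) :
    MemLp (stdHermite S j) 2 (gaussianLaw S) := by
  simpa only [stdHermite, div_eq_mul_inv] using! (memLp_hermite hS j).mul_const _

/-- Division by zero is harmless: if the norm vanishes, `H_j` is zero almost everywhere. Positivity
of the norm is thus never needed. -/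
lemma hermite_ae_eq (hS : S.PosDef) (j : Fin N → ℕ) :
    ∀ᵐ x ∂(gaussianLaw S),
      hermite S j x = √(∫ z, hermite S j z ^ 2 ∂(gaussianLaw S)) * stdHermite S j x := by
  by_cases h : ∫ z, hermite S j z ^ 2 ∂(gaussianLaw S) = 0
  · rw [integral_eq_zero_iff_of_nonneg (fun z => sq_nonneg _) (memLp_hermite hS j).integrable_sq]
      at h
    filter_upwards [h] with x hx
    have : hermite S j x = 0 := by simpa using hx
    simp [stdHermite, this]
  · refine Eventually.of_forall fun x => ?_
    have hpos : 0 < ∫ z, hermite S j z ^ 2 ∂(gaussianLaw S) :=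
      lt_of_le_of_ne (integral_nonneg fun z => sq_nonneg _) (Ne.symm h)
    have := (Real.sqrt_pos.2 hpos).ne'
    rw [stdHermite]
    field_simp

lemma integral_stdHermite_mul_stdHermite (hS : S.PosDef) {j k : Fin N → ℕ}
    (hjk : degree j ≠ degree k) :
    ∫ x, stdHermite S j x * stdHermite S k x ∂(gaussianLaw S) = 0 := by
  simp only [stdHermite, div_mul_div_comm, integral_div, integral_hermite_mul_hermite hS hjk,
    zero_div]

/-- A square-integrable function orthogonal to all standardized Hermite polynomials vanishes. -/
theorem ae_eq_zero_of_integral_mul_stdHermite (hS : S.PosDef) {f : (Fin N → ℝ) → ℝ}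
    (hf : MemLp f 2 (gaussianLaw S))
    (h : ∀ j, ∫ x, f x * stdHermite S j x ∂(gaussianLaw S) = 0) : f =ᵐ[gaussianLaw S] 0 := by
  refine ae_eq_zero_of_integral_mul_eval_eq_zero (integrable_exp_gaussianLaw hS) hf fun p => ?_
  have hint (p : MvPolynomial (Fin N) ℝ) :
      Integrable (fun x => f x * eval x p) (gaussianLaw S) :=
    hf.integrable_mul (memLp_eval_two (integrable_exp_gaussianLaw hS) p)
  have hp : p ∈ Submodule.span ℝ (Set.range (hermitePoly S⁻¹)) := by
    rw [span_hermitePoly _ (transpose_inv_eq hS) hS.inv.det_pos.ne'.isUnit]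
    trivial
  induction hp using Submodule.span_induction with
  | mem p hp =>
    obtain ⟨j, rfl⟩ := hp
    rw [← mul_zero √(∫ z, hermite S j z ^ 2 ∂(gaussianLaw S)), ← h j, ← integral_const_mul]
    refine integral_congr_ae ?_
    filter_upwards [hermite_ae_eq hS j] with x hx
    rw [← hermite_eq_eval hS, hx]
    ring
  | zero => simp
  | add p q _ _ hp hq =>
    simp only [eval_add, mul_add]
    rw [integral_add (hint p) (hint q), hp, hq, add_zero]
  | smul c p _ hp =>
    simp only [smul_eval, mul_left_comm _ c, integral_const_mul, hp, mul_zero]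

end Gaussian

/-! ### Expectations as inner products in L² of the law -/

section LawTransfer

open scoped InnerProductSpace

variable {Ω E : Type*} [MeasurableSpace Ω] [MeasurableSpace E] {P : Measure Ω} {μ : Measure E}
  {X : Ω → E}

lemma memLp_comp_of_hasLaw (hX : HasLaw X μ P) {f : E → ℝ} {p : ENNReal} (hf : MemLp f p μ) :
    MemLp (fun ω => f (X ω)) p P := by
  have h := hX.map_eq ▸ hf
  exact (memLp_map_measure_iff h.aestronglyMeasurable hX.aemeasurable).1 h

lemma integral_comp_mul_comp_eq_inner (hX : HasLaw X μ P) {f g : E → ℝ} (hf : MemLp f 2 μ)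
    (hg : MemLp g 2 μ) : ∫ ω, f (X ω) * g (X ω) ∂P = ⟪hf.toLp f, hg.toLp g⟫_ℝ := by
  have h : ∫ ω, f (X ω) * g (X ω) ∂P = ∫ x, f x * g x ∂μ :=
    hX.integral_comp (hf.aestronglyMeasurable.mul hg.aestronglyMeasurable)
  rw [h, L2.inner_def]
  refine integral_congr_ae ?_
  filter_upwards [hf.coeFn_toLp, hg.coeFn_toLp] with x h1 h2
  rw [h1, h2, real_inner_eq_re_inner, RCLike.inner_apply]
  simp [mul_comm]

lemma toLp_finsetSum {ι : Type*} (s : Finset ι) {f : ι → E → ℝ} (hf : ∀ i, MemLp (f i) 2 μ) :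
    (memLp_finsetSum s fun i _ => hf i).toLp (fun x => ∑ i ∈ s, f i x) =
      ∑ i ∈ s, (hf i).toLp (f i) := by
  classical
  induction s using Finset.induction_on with
  | empty => simpa using! MemLp.toLp_zero _
  | insert a s ha ih =>
    rw [Finset.sum_insert ha, ← ih, ← MemLp.toLp_add]
    simp only [Finset.sum_insert ha]
    rfl

end LawTransfer

/-! ### The standardized Hermite family in L² -/

section Expansion

open scoped InnerProductSpace

variable {N : ℕ} {S : Matrix (Fin N) (Fin N) ℝ} [IsFiniteMeasure (gaussianLaw S)]

/-- The standardized Hermite polynomials as elements of `L²`. -/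
noncomputable def stdHermiteLp (hS : S.PosDef) (j : Fin N → ℕ) : Lp ℝ 2 (gaussianLaw S) :=
  (memLp_stdHermite hS j).toLp (stdHermite S j)

lemma memLp_truncatedPCE (hS : S.PosDef) (C : (Fin N → ℕ) → ℝ) (m : ℕ) :
    MemLp (truncatedPCE S C m) 2 (gaussianLaw S) :=
  memLp_finsetSum _ fun _ _ => memLp_finsetSum _ fun j _ => (memLp_stdHermite hS j).const_mul _

lemma toLp_truncatedPCE (hS : S.PosDef) (C : (Fin N → ℕ) → ℝ) (m : ℕ) :
    (memLp_truncatedPCE hS C m).toLp (truncatedPCE S C m) =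
      ∑ l ∈ Finset.range (m + 1), ∑ j ∈ Finset.piAntidiag Finset.univ l,
        C j • stdHermiteLp hS j := by
  have h (l : ℕ) := toLp_finsetSum (Finset.piAntidiag (Finset.univ : Finset (Fin N)) l)
    fun j => (memLp_stdHermite hS j).const_mul (C j)
  refine (toLp_finsetSum (Finset.range (m + 1)) fun l => memLp_finsetSum
    (Finset.piAntidiag Finset.univ l) fun j _ =>
      (memLp_stdHermite hS j).const_mul (C j)).trans (Finset.sum_congr rfl fun l _ => ?_)
  rw [h]
  exact Finset.sum_congr rfl fun j _ => MemLp.toLp_const_smul (C j) (memLp_stdHermite hS j)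

lemma inner_stdHermiteLp (hS : S.PosDef) (j k : Fin N → ℕ) (hjk : degree j ≠ degree k) :
    ⟪stdHermiteLp hS j, stdHermiteLp hS k⟫_ℝ = 0 := by
  rw [stdHermiteLp, stdHermiteLp, ← integral_comp_mul_comp_eq_inner HasLaw.id]
  exact integral_stdHermite_mul_stdHermite hS hjk

lemma topologicalClosure_span_stdHermiteLp (hS : S.PosDef) :
    (Submodule.span ℝ (Set.range (stdHermiteLp hS))).topologicalClosure = ⊤ := by
  rw [Submodule.topologicalClosure_eq_top_iff, Submodule.eq_bot_iff]
  intro f hf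
  have hfL : MemLp f 2 (gaussianLaw S) := Lp.memLp f
  refine (Lp.eq_zero_iff_ae_eq_zero).2 (ae_eq_zero_of_integral_mul_stdHermite hS hfL fun j => ?_)
  have h := integral_comp_mul_comp_eq_inner HasLaw.id hfL (memLp_stdHermite hS j)
  rw [Lp.toLp_coeFn, real_inner_comm] at h
  exact h.trans (hf _ (Submodule.subset_span ⟨j, rfl⟩))

lemma mem_piAntidiag_univ_iff (l : ℕ) (k : Fin N → ℕ) :
    k ∈ Finset.piAntidiag Finset.univ l ↔ degree k = l := by
  simp [degree]

end Expansion

end GeneralizedPCE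

/-! ### The expansion theorem -/

open GeneralizedPCE
theorem corollary16 {Ω : Type*} [MeasurableSpace Ω] (P : Measure Ω) [IsProbabilityMeasure P]
    {N : ℕ} (S : Matrix (Fin N) (Fin N) ℝ) (hS : S.PosDef)
    (X : Ω → Fin N → ℝ) (hX : HasLaw X (GeneralizedPCE.gaussianLaw S) P)
    (y : (Fin N → ℝ) → ℝ) (hy : AEMeasurable y (GeneralizedPCE.gaussianLaw S))
    (hyX : MemLp (fun ω => y (X ω)) 2 P) :
    (∃ C : (Fin N → ℕ) → ℝ, GeneralizedPCE.IsPCECoeff P S X y C) ∧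
    ∀ C : (Fin N → ℕ) → ℝ, GeneralizedPCE.IsPCECoeff P S X y C →
      (∀ m : ℕ,
        MemLp (fun ω => y (X ω) - GeneralizedPCE.truncatedPCE S C m (X ω)) 2 P ∧
        ∀ g ∈ Submodule.span ℝ {f : Ω → ℝ | ∃ j : Fin N → ℕ, GeneralizedPCE.degree j ≤ m ∧
            f = fun ω => GeneralizedPCE.stdHermite S j (X ω)},
          MemLp g 2 P ∧
          ∫ ω, (y (X ω) - GeneralizedPCE.truncatedPCE S C m (X ω)) * g ω ∂P = 0) ∧
      Tendsto (fun m : ℕ => ∫ ω, (y (X ω) - GeneralizedPCE.truncatedPCE S C m (X ω)) ^ 2 ∂P)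
        atTop (𝓝 0) := by
  -- The total mass of the Gaussian is not computed; it is inherited from `P` through the law of
  -- `X`.
  have : IsProbabilityMeasure (gaussianLaw S) := hX.isProbabilityMeasure_iff.1 inferInstance
  have hyL : MemLp y 2 (gaussianLaw S) := by
    rw [← hX.map_eq] at hy ⊢
    exact (memLp_map_measure_iff hy.aestronglyMeasurable hX.aemeasurable).2 hyX
  have hiff (C : (Fin N → ℕ) → ℝ) : IsPCECoeff P S X y C ↔
      ∀ j, ∑ k ∈ Finset.piAntidiag Finset.univ (degree j),
        C k * inner ℝ (stdHermiteLp hS j) (stdHermiteLp hS k) =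
          inner ℝ (hyL.toLp y) (stdHermiteLp hS j) := by
    simp only [IsPCECoeff, stdHermiteLp,
      integral_comp_mul_comp_eq_inner hX hyL (memLp_stdHermite hS _),
      integral_comp_mul_comp_eq_inner hX (memLp_stdHermite hS _) (memLp_stdHermite hS _)]
  have hsub (C : (Fin N → ℕ) → ℝ) (m : ℕ) :
      MemLp (fun x => y x - truncatedPCE S C m x) 2 (gaussianLaw S) :=
    hyL.sub (memLp_truncatedPCE hS C m)
  have htoLp (C : (Fin N → ℕ) → ℝ) (m : ℕ) :
      (hsub C m).toLp (fun x => y x - truncatedPCE S C m x) = hyL.toLp y -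
        ∑ l ∈ Finset.range (m + 1), ∑ j ∈ Finset.piAntidiag Finset.univ l,
          C j • stdHermiteLp hS j := by
    rw [← toLp_truncatedPCE, ← MemLp.toLp_sub]
    rfl
  refine ⟨?_, fun C hC => ⟨fun m => ⟨memLp_comp_of_hasLaw hX (hsub C m), fun g hg => ?_⟩, ?_⟩⟩
  · simp only [hiff]
    exact exists_coeff_of_levels mem_piAntidiag_univ_iff _
  · have hres := memLp_comp_of_hasLaw hX (hsub C m)
    induction hg using Submodule.span_induction with
    | mem g hg =>
      obtain ⟨j, hj, rfl⟩ := hg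
      refine ⟨memLp_comp_of_hasLaw hX (memLp_stdHermite hS j), ?_⟩
      rw [integral_comp_mul_comp_eq_inner hX (hsub C m) (memLp_stdHermite hS j), htoLp]
      exact inner_sub_levels_eq_zero mem_piAntidiag_univ_iff (inner_stdHermiteLp hS)
        ((hiff C).1 hC) hj
    | zero => exact ⟨MemLp.zero, by simp⟩
    | add f g _ _ hf hg =>
      refine ⟨hf.1.add hg.1, ?_⟩
      simp only [Pi.add_apply, mul_add]
      refine (integral_add (hres.integrable_mul hf.1) (hres.integrable_mul hg.1)).trans ?_
      rw [← add_zero (0 : ℝ)]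
      exact congrArg₂ (· + ·) hf.2 hg.2
    | smul c g _ hg =>
      refine ⟨hg.1.const_smul c, ?_⟩
      simp only [Pi.smul_apply, smul_eq_mul, mul_left_comm _ c, integral_const_mul, hg.2, mul_zero]
  · have h := tendsto_norm_sub_levels mem_piAntidiag_univ_iff (inner_stdHermiteLp hS)
      ((hiff C).1 hC) (by rw [topologicalClosure_span_stdHermiteLp]; trivial)
    refine (by simpa using h.pow 2 : Tendsto _ _ (𝓝 (0 : ℝ))).congr fun m => ?_
    simp only [sq (y _ - _)]
    rw [integral_comp_mul_comp_eq_inner hX (hsub C m) (hsub C m), htoLp, real_inner_self_eq_norm_sq]
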